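/- For $t\in\mathbb{R}$ let $w(z)=w(z;t)=\frac{1}{2\pi I_0(t)}\exp\!\big(\tfrac12 t(z+z^{-1})\big)$ on $|z|=1$, where $I_\nu(t)=\sum_{k\ge 0}\frac{(t/2)^{2k+\nu}}{k!\,(k+\nu)!}$ is the modified Bessel function of the first kind. Let $(\phi_n)_{n\ge 0}$, $\phi_n(z)=\phi_n(z;t)=\kappa_n z^n+\text{lower order terms}$ with $\kappa_n=\kappa_n(t)>0$, be the polynomials orthonormal with respect to $w$ on the unit circle: $$\int_{|\zeta|=1}\phi_m(\zeta)\overline{\phi_n(\zeta)}\,w(\zeta)\,\frac{d\zeta}{i\zeta}=\delta_{m,n}.$$ Then $\frac{d}{dt}\phi_0(z)=0$ for all $t\in\mathbb{R}$ and $z\in\mathbb{C}$. For all $n\ge 1$ and all real $t\neq 0$ one has $\phi_n(0)\neq 0$, the functions $\phi_n(z)$ ($z\in\mathbb{C}$ fixed) are differentiable in $t$, and for every $z\in\mathbb{C}$ $$2\frac{d}{dt}\phi_n(z)=\left[\frac{I_1(t)}{I_0(t)}+\frac{\phi_{n+1}(0)}{\kappa_{n+1}}\frac{\kappa_n}{\phi_n(0)}\right]\phi_n(z)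 -\frac{\kappa_{n-1}}{\kappa_n}\left[1+\frac{\phi_{n+1}(0)}{\kappa_{n+1}}\frac{\kappa_n}{\phi_n(0)}\,z\right]\phi_{n-1}(z),$$ $$\frac{2}{\phi_n(0)}\frac{d}{dt}\phi_n(0)=\frac{I_1(t)}{I_0(t)}+\frac{\phi_{n+1}(0)}{\kappa_{n+1}}\frac{\kappa_n}{\phi_n(0)} -\frac{\phi_{n-1}(0)}{\phi_n(0)}\frac{\kappa_{n-1}}{\kappa_n}.$$ For all $n\ge 1$ and all $t\in\mathbb{R}$, $\kappa_n$ is differentiable in $t$ and $$\frac{2}{\kappa_n}\frac{d}{dt}\kappa_n=\frac{I_1(t)}{I_0(t)}+\frac{\phi_{n+1}(0)}{\kappa_{n+1}}\frac{\phi_n(0)}{\kappa_n}.$$ -/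

import Mathlib

open Polynomial

noncomputable section

/-- The modified Bessel function of the first kind `I_ν(t)` of integer order `ν ≥ 0`, by its
(everywhere convergent) power series. -/
def besselI (ν : ℕ) (t : ℝ) : ℝ :=
  ∑' k : ℕ, (t / 2) ^ (2 * k + ν) / ((k.factorial : ℝ) * ((k + ν).factorial : ℝ))

/-- The modified Bessel weight `w(z) = exp(t (z + z⁻¹) / 2) / (2 π I_0(t))`. -/
def besselWeight (t : ℝ) (z : ℂ) : ℂ :=
  1 / (2 * (Real.pi : ℂ) * (besselI 0 t : ℂ)) * Complex.exp ((1 / 2) * (t : ℂ) * (z + z⁻¹))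

/-- The pairing `∫_{|ζ|=1} p(ζ) conj(q(ζ)) w(ζ) dζ / (i ζ)` of two polynomials. -/
def circlePairing (w : ℂ → ℂ) (p q : ℂ[X]) : ℂ :=
  ∮ ζ in C(0, 1), p.eval ζ * (starRingEnd ℂ) (q.eval ζ) * w ζ / (Complex.I * ζ)

/-- `p` is the sequence of orthonormal polynomials on the unit circle with respect to `w`:
`p n` has degree exactly `n`, its leading coefficient is a positive real number, and the
sequence is orthonormal. -/
structure IsOPUC (w : ℂ → ℂ) (p : ℕ → ℂ[X]) : Prop where
  natDegree_eq : ∀ n, (p n).natDegree = n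
  leadingCoeff_re_pos : ∀ n, 0 < (p n).leadingCoeff.re
  leadingCoeff_im : ∀ n, (p n).leadingCoeff.im = 0
  orthonormal : ∀ m n, circlePairing w (p m) (p n) = if m = n then 1 else 0

theorem besselI_zero_pos (t : ℝ) : 0 < besselI 0 t := by
  have hnn : ∀ k : ℕ, 0 ≤ (t / 2) ^ (2 * k + 0) / ((k.factorial : ℝ) * ((k + 0).factorial : ℝ)) := by
    intro k
    rw [add_zero, pow_mul]
    positivity
  have hs : Summable fun k : ℕ =>
      (t / 2) ^ (2 * k + 0) / ((k.factorial : ℝ) * ((k + 0).factorial : ℝ)) := by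
    refine Summable.of_nonneg_of_le hnn ?_ (Real.summable_pow_div_factorial ((t / 2) ^ 2))
    intro k
    rw [add_zero, add_zero, pow_mul]
    have h1 : (1 : ℝ) ≤ k.factorial := by exact_mod_cast Nat.factorial_pos k
    apply div_le_div_of_nonneg_left (by positivity) (by positivity)
    nlinarith
  exact hs.tsum_pos hnn 0 (by simp)

/-- The pairing as an integral over the angle. -/
theorem circlePairing_besselWeight (t : ℝ) (p q : ℂ[X]) :
    circlePairing (besselWeight t) p q =
      ∫ θ in (0 : ℝ)..2 * Real.pi,
        (p.eval (circleMap 0 1 θ) * (starRingEnd ℂ) (q.eval (circleMap 0 1 θ))) *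
          ((1 / (2 * Real.pi * besselI 0 t) * Real.exp (t * Real.cos θ) : ℝ) : ℂ) := by
  unfold circlePairing circleIntegral
  apply intervalIntegral.integral_congr
  intro θ _
  have h0 : circleMap 0 1 θ ≠ 0 := circleMap_ne_center one_ne_zero
  have hinv : circleMap 0 1 θ + (circleMap 0 1 θ)⁻¹ = 2 * Complex.cos θ := by
    simp only [circleMap, zero_add, Complex.ofReal_one, one_mul, ← Complex.exp_neg]
    rw [Complex.two_cos, neg_mul]
  have hw : besselWeight t (circleMap 0 1 θ) =
      ((1 / (2 * Real.pi * besselI 0 t) * Real.exp (t * Real.cos θ) : ℝ) : ℂ) := by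
    unfold besselWeight
    rw [hinv]
    push_cast
    congr 2
    ring
  simp only [deriv_circleMap, smul_eq_mul]
  rw [hw]
  field_simp [h0, Complex.I_ne_zero]

theorem continuous_circlePairing_integrand (t : ℝ) (p q : ℂ[X]) :
    Continuous fun θ : ℝ =>
      (p.eval (circleMap 0 1 θ) * (starRingEnd ℂ) (q.eval (circleMap 0 1 θ))) *
        ((1 / (2 * Real.pi * besselI 0 t) * Real.exp (t * Real.cos θ) : ℝ) : ℂ) := by
  have h1 : ∀ r : ℂ[X], Continuous fun θ : ℝ => r.eval (circleMap 0 1 θ) :=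
    fun r => r.continuous.comp (continuous_circleMap 0 1)
  refine ((h1 p).mul (Complex.continuous_conj.comp (h1 q))).mul
    (Complex.continuous_ofReal.comp ?_)
  fun_prop

theorem circlePairing_self (t : ℝ) (p : ℂ[X]) :
    circlePairing (besselWeight t) p p =
      ((∫ θ in (0 : ℝ)..2 * Real.pi, ‖p.eval (circleMap 0 1 θ)‖ ^ 2 *
          (1 / (2 * Real.pi * besselI 0 t) * Real.exp (t * Real.cos θ)) : ℝ) : ℂ) := by
  rw [circlePairing_besselWeight, ← intervalIntegral.integral_ofReal]
  apply intervalIntegral.integral_congr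
  intro θ _
  simp only [Complex.mul_conj']
  push_cast
  ring

/-- The pairing is an inner product on polynomials. -/
abbrev circleCore (t : ℝ) : InnerProductSpace.Core ℂ ℂ[X] where
  inner p q := circlePairing (besselWeight t) q p
  conj_inner_symm p q := by
    simp only [circlePairing_besselWeight]
    simp only [intervalIntegral.integral_of_le (show (0 : ℝ) ≤ 2 * Real.pi by positivity)]
    rw [← integral_conj]
    congr 1
    ext θ
    simp only [map_mul, Complex.conj_conj, Complex.conj_ofReal]
    ring
  re_inner_nonneg p := by
    simp only [circlePairing_self]
    refine le_of_le_of_eq ?_ (Complex.ofReal_re _).symm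
    apply intervalIntegral.integral_nonneg (by positivity)
    intro θ _
    have := besselI_zero_pos t
    positivity
  add_left p q r := by
    simp only [circlePairing_besselWeight]
    rw [← intervalIntegral.integral_add
      ((continuous_circlePairing_integrand t _ _).intervalIntegrable _ _)
      ((continuous_circlePairing_integrand t _ _).intervalIntegrable _ _)]
    apply intervalIntegral.integral_congr
    intro θ _
    simp only [eval_add, map_add]
    ring
  smul_left p q c := by
    simp only [circlePairing_besselWeight]
    rw [← intervalIntegral.integral_const_mul]
    apply intervalIntegral.integral_congr
    intro θ _
    simp only [eval_smul, smul_eq_mul, map_mul]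
    ring
  definite p hp := by
    by_contra hne
    have hp' : circlePairing (besselWeight t) p p = 0 := hp
    rw [circlePairing_self, Complex.ofReal_eq_zero] at hp'
    have hI := besselI_zero_pos t
    obtain ⟨θ, hθ, hev⟩ : ∃ θ ∈ Set.Icc (0 : ℝ) (2 * Real.pi), p.eval (circleMap 0 1 θ) ≠ 0 := by
      by_contra! hall
      apply hne
      apply Polynomial.eq_zero_of_infinite_isRoot
      refine Set.infinite_of_injOn_mapsTo (s := Set.Ico (0 : ℝ) 1) (f := circleMap 0 1) ?_ ?_
        (Set.Ico_infinite one_pos)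
      · exact injOn_circleMap_of_abs_sub_le' one_ne_zero (by linarith [Real.pi_gt_three])
      · intro θ hθ
        exact hall θ ⟨hθ.1, hθ.2.le.trans (by linarith [Real.pi_gt_three])⟩
    have hpos := intervalIntegral.integral_pos (a := 0) (b := 2 * Real.pi)
      (f := fun θ : ℝ => ‖p.eval (circleMap 0 1 θ)‖ ^ 2 *
          (1 / (2 * Real.pi * besselI 0 t) * Real.exp (t * Real.cos θ))) (by positivity)
      (by
        have h1 : Continuous fun θ : ℝ => p.eval (circleMap 0 1 θ) :=
          p.continuous.comp (continuous_circleMap 0 1)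
        exact ((h1.norm.pow 2).mul (by fun_prop)).continuousOn)
      (fun θ _ => by positivity)
      ⟨θ, hθ, by
        have := norm_pos_iff.mpr hev
        positivity⟩
    exact hpos.ne' hp'

theorem exists_isOPUC (t : ℝ) : ∃ p : ℕ → ℂ[X], IsOPUC (besselWeight t) p := by
  let := circleCore t
  let : NormedAddCommGroup ℂ[X] := InnerProductSpace.Core.toNormedAddCommGroup (𝕜 := ℂ)
  let : InnerProductSpace ℂ ℂ[X] := InnerProductSpace.ofCore (circleCore t).toCore
  have hinner : ∀ p q : ℂ[X], inner ℂ p q = circlePairing (besselWeight t) q p := fun _ _ => rfl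
  set f : ℕ → ℂ[X] := fun n => X ^ n with hf
  have hli : LinearIndependent ℂ f := by
    have := (Polynomial.basisMonomials ℂ).linearIndependent
    rw [Polynomial.coe_basisMonomials] at this
    simpa only [hf, X_pow_eq_monomial] using this
  have hspan : ∀ n, InnerProductSpace.gramSchmidt ℂ f n ∈ degreeLT ℂ (n + 1) := by
    intro n
    have h1 := InnerProductSpace.gramSchmidt_mem_span ℂ f (le_refl n)
    refine (Submodule.span_le.2 ?_) h1
    rintro _ ⟨k, hk, rfl⟩
    exact mem_degreeLT.2 ((degree_X_pow_le k).trans_lt (by exact_mod_cast Nat.lt_succ_of_le hk))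
  have hlow : ∀ n, (f n - InnerProductSpace.gramSchmidt ℂ f n).degree < n := by
    intro n
    rw [InnerProductSpace.gramSchmidt_def, sub_sub_cancel]
    rw [← mem_degreeLT]
    refine Submodule.sum_mem _ fun i hi => ?_
    have hi' : i + 1 ≤ n := Finset.mem_Iio.1 hi
    have h2 : Submodule.span ℂ {InnerProductSpace.gramSchmidt ℂ f i} ≤ degreeLT ℂ n := by
      rw [Submodule.span_singleton_le_iff_mem]
      exact degreeLT_mono hi' (hspan i)
    exact h2 (Submodule.starProjection_apply_mem _ _)
  have hmonic : ∀ n, (InnerProductSpace.gramSchmidt ℂ f n).Monic ∧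
      (InnerProductSpace.gramSchmidt ℂ f n).natDegree = n := by
    intro n
    have h3 : InnerProductSpace.gramSchmidt ℂ f n =
        X ^ n + -(f n - InnerProductSpace.gramSchmidt ℂ f n) := by
      simp only [hf]; ring
    have h4 : (-(f n - InnerProductSpace.gramSchmidt ℂ f n)).degree < n := by
      rw [degree_neg]; exact hlow n
    rw [h3]
    exact ⟨monic_X_pow_add h4, natDegree_eq_of_degree_eq_some
      ((degree_add_eq_left_of_degree_lt (by rwa [degree_X_pow])).trans (degree_X_pow n))⟩
  have hnorm : ∀ n, 0 < ‖InnerProductSpace.gramSchmidt ℂ f n‖ := fun n =>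
    norm_pos_iff.2 (InnerProductSpace.gramSchmidt_ne_zero n hli)
  have hlead : ∀ n, (InnerProductSpace.gramSchmidtNormed ℂ f n).leadingCoeff =
      ((‖InnerProductSpace.gramSchmidt ℂ f n‖⁻¹ : ℝ) : ℂ) := by
    intro n
    unfold InnerProductSpace.gramSchmidtNormed
    rw [smul_eq_C_mul, leadingCoeff_mul, leadingCoeff_C, (hmonic n).1.leadingCoeff, mul_one]
    simp
  refine ⟨InnerProductSpace.gramSchmidtNormed ℂ f, ?_, ?_, ?_, ?_⟩
  · intro n
    unfold InnerProductSpace.gramSchmidtNormed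
    rw [natDegree_smul_of_smul_regular, (hmonic n).2]
    apply IsSMulRegular.of_ne_zero
    simpa using (hnorm n).ne'
  · intro n
    rw [hlead, Complex.ofReal_re]
    exact inv_pos.2 (hnorm n)
  · intro n
    rw [hlead, Complex.ofReal_im]
  · intro m n
    have h5 := (orthonormal_iff_ite.1 (InnerProductSpace.gramSchmidtNormed_orthonormal hli)) n m
    rw [hinner] at h5
    rw [h5]
    simp only [eq_comm]

theorem isOPUC_unique (t : ℝ) {p q : ℕ → ℂ[X]} (hp : IsOPUC (besselWeight t) p)
    (hq : IsOPUC (besselWeight t) q) : p = q := by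
  let := circleCore t
  let : NormedAddCommGroup ℂ[X] := InnerProductSpace.Core.toNormedAddCommGroup (𝕜 := ℂ)
  let : InnerProductSpace ℂ ℂ[X] := InnerProductSpace.ofCore (circleCore t).toCore
  have hinner : ∀ p q : ℂ[X], inner ℂ p q = circlePairing (besselWeight t) q p := fun _ _ => rfl
  have hlead : ∀ {p : ℕ → ℂ[X]}, IsOPUC (besselWeight t) p → ∀ n,
      (p n).leadingCoeff = (((p n).leadingCoeff.re : ℝ) : ℂ) ∧ (p n).leadingCoeff ≠ 0 := by
    intro p hp n
    refine ⟨Complex.ext (by simp) (by simpa using hp.leadingCoeff_im n), fun h => ?_⟩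
    have := hp.leadingCoeff_re_pos n
    rw [h] at this
    simp at this
  -- an orthonormal system is orthogonal to all polynomials of lower degree
  have horth : ∀ {p : ℕ → ℂ[X]}, IsOPUC (besselWeight t) p → ∀ (m n : ℕ) (r : ℂ[X]), m ≤ n →
      r.degree < m → inner ℂ (p n) r = 0 := by
    intro p hp m
    induction m with
    | zero =>
      intro n r _ hr
      have : r = 0 := by
        rw [← degree_eq_bot]
        exact Nat.WithBot.lt_zero_iff.1 (by simpa using hr)
      rw [this, inner_zero_right]
    | succ m ih =>
      intro n r hmn hr
      have hl := (hlead hp m).2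
      set c : ℂ := r.coeff m / (p m).leadingCoeff with hc
      have h1 : (r - c • p m).degree < m := by
        rw [degree_lt_iff_coeff_zero]
        intro k hk
        rcases hk.eq_or_lt with rfl | hk
        · have h2 : (p m).coeff m = (p m).leadingCoeff := by
            rw [leadingCoeff, hp.natDegree_eq]
          rw [coeff_sub, coeff_smul, h2, smul_eq_mul, hc, div_mul_cancel₀ _ hl, sub_self]
        · rw [coeff_sub, coeff_smul, (degree_lt_iff_coeff_zero _ _).1 hr k hk,
            coeff_eq_zero_of_natDegree_lt (by rw [hp.natDegree_eq]; exact hk), smul_zero, sub_zero]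
      have h3 := ih n _ (by omega) h1
      rw [inner_sub_right, inner_smul_right, hinner (p n) (p m), hp.orthonormal,
        if_neg (by omega), mul_zero, sub_zero] at h3
      exact h3
  have hself : ∀ {p : ℕ → ℂ[X]}, IsOPUC (besselWeight t) p → ∀ n, inner ℂ (p n) (p n) = 1 := by
    intro p hp n
    rw [hinner, hp.orthonormal, if_pos rfl]
  funext n
  set a := (p n).leadingCoeff.re with ha
  set b := (q n).leadingCoeff.re with hb
  have hapos : 0 < a := hp.leadingCoeff_re_pos n
  have hbpos : 0 < b := hq.leadingCoeff_re_pos n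
  have hdeg : ((b : ℂ) • p n - (a : ℂ) • q n).degree < n := by
    rw [degree_lt_iff_coeff_zero]
    intro k hk
    rcases hk.eq_or_lt with rfl | hk
    · have h1 : (p n).coeff n = (a : ℂ) := by
        rw [ha, ← (hlead hp n).1, leadingCoeff, hp.natDegree_eq]
      have h2 : (q n).coeff n = (b : ℂ) := by
        rw [hb, ← (hlead hq n).1, leadingCoeff, hq.natDegree_eq]
      rw [coeff_sub, coeff_smul, coeff_smul, h1, h2, smul_eq_mul, smul_eq_mul]
      ring
    · rw [coeff_sub, coeff_smul, coeff_smul,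
        coeff_eq_zero_of_natDegree_lt (by rw [hp.natDegree_eq]; exact hk),
        coeff_eq_zero_of_natDegree_lt (by rw [hq.natDegree_eq]; exact hk), smul_zero, smul_zero,
        sub_zero]
  have hzero : (b : ℂ) • p n - (a : ℂ) • q n = 0 := by
    rw [← inner_self_eq_zero (𝕜 := ℂ)]
    rw [inner_sub_left, inner_smul_left, inner_smul_left, horth hp n n _ le_rfl hdeg,
      horth hq n n _ le_rfl hdeg]
    simp
  have heq : (b : ℂ) • p n = (a : ℂ) • q n := sub_eq_zero.1 hzero
  have hab : a = b := by
    have h1 : inner ℂ ((b : ℂ) • p n) ((b : ℂ) • p n) = ((b * b : ℝ) : ℂ) := by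
      rw [inner_smul_left, inner_smul_right, hself hp]
      simp
    have h2 : inner ℂ ((a : ℂ) • q n) ((a : ℂ) • q n) = ((a * a : ℝ) : ℂ) := by
      rw [inner_smul_left, inner_smul_right, hself hq]
      simp
    rw [heq, h2, Complex.ofReal_inj] at h1
    nlinarith
  rw [hab] at heq
  exact smul_right_injective _ (Complex.ofReal_ne_zero.2 hbpos.ne') heq

theorem existsUnique_isOPUC (t : ℝ) : ∃! p : ℕ → ℂ[X], IsOPUC (besselWeight t) p := by
  obtain ⟨p, hp⟩ := exists_isOPUC t
  exact ⟨p, hp, fun q hq => isOPUC_unique t hq hp⟩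

/-- The modified Bessel orthonormal polynomials: `besselOPUC t n` is `φ_n` at parameter `t`, where
`(φ_n)` is the unique orthonormal system on the unit circle for the weight `besselWeight t`. -/
def besselOPUC (t : ℝ) : ℕ → ℂ[X] :=
  (existsUnique_isOPUC t).choose

theorem besselOPUC_isOPUC (t : ℝ) : IsOPUC (besselWeight t) (besselOPUC t) :=
  (existsUnique_isOPUC t).choose_spec.1

/-- `besselPhi n t z` is the value `φ_n(z)` at parameter `t`. -/
def besselPhi (n : ℕ) (t : ℝ) (z : ℂ) : ℂ :=
  (besselOPUC t n).eval z

/-- `besselKappa n t` is the (positive real) leading coefficient `κ_n` of `φ_n` at parameter `t`. -/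
def besselKappa (n : ℕ) (t : ℝ) : ℝ :=
  (besselOPUC t n).leadingCoeff.re

end

/-!
The moments of the weight `e^{t cos θ} / (2π)` are `c_k = I_{|k|}(t)`, so they are real and satisfy
`c_k' = (c_{k+1} + c_{k-1}) / 2` and, by integration by parts, `k c_k = (t/2) (c_{k-1} - c_{k+1})`.
Since the moments are real and symmetric, the monic orthogonal polynomials `Φ_n` are real and are
given by the Szegő recurrence `Φ_{n+1} = z Φ_n + r_{n+1} Φ_n^*` with `r_n = Φ_n(0)`; the recurrence
expresses their coefficients rationally through the moments, so they are differentiable in `t`. By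
uniqueness of the orthonormal system, `φ_n = κ_n Φ_n` with `κ_n² = I_0 / h_n`, where `h_n` is the
squared norm of `Φ_n` and `h_{n+1} = h_n (1 - r_{n+1}²)`.

Differentiating the relations `⟨Φ_{n+1}, z^j⟩ = 0`, `0 ≤ j ≤ n`, in `t`, the factor `cos θ` shifts
`j` by one in either direction, so that only `j = 0` and `j = n` contribute; comparing moments
yields (`hasCoeffDerivAt_monicOPUC`)
`dΦ_{n+1}/dt = (1/2) (1 - r_{n+1}²) (r_{n+2} Φ_n^* - Φ_n)`.
With `r_{n+1} Φ_n^* = Φ_{n+1} - z Φ_n` and `dh_n/dt = -r_n r_{n+1} h_n` this gives the differential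
relations.

It remains to see that `r_n ≠ 0` for `t ≠ 0`. The same argument for `z dΦ_{n+1}/dz`
(`X_mul_derivative_monicOPUC`) gives, at `z = 0`, the discrete Painlevé II equation, and eliminating
`r_{n+2}` between it and the differential equation for `r_{n+1}` leaves
`(d/dt) ((-t)^{n+1} r_{n+1}) = t (1 - r_{n+1}²) ((-t)^n r_n)`. As `(-t)^{n+1} r_{n+1}` vanishes at
`t = 0` and `r_{n+1}² < 1`, induction shows `(-t)^n r_n > 0` for all `t ≠ 0`
(`neg_pow_mul_reflectionCoeff_pos`).
-/

noncomputable section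

/-! ### Trigonometric moments of the Bessel weight -/

/-- The `k`-th trigonometric moment `∫₀^{2π} e^{ikθ} e^{t cos θ} dθ` of the unnormalized weight. -/
def trigMoment (k : ℤ) (t : ℝ) : ℂ :=
  ∫ θ in (0 : ℝ)..2 * Real.pi,
    Complex.exp (k * θ * Complex.I) * Complex.exp ((t : ℂ) * Complex.cos θ)

theorem integral_exp_int_mul_I (k : ℤ) :
    ∫ θ in (0 : ℝ)..2 * Real.pi, Complex.exp (k * θ * Complex.I) =
      if k = 0 then (2 * Real.pi : ℂ) else 0 := by
  split_ifs with hk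
  · simp [hk]
  · have hc : (k : ℂ) * Complex.I ≠ 0 := by simp [hk, Complex.I_ne_zero]
    have h := integral_exp_mul_complex (a := 0) (b := 2 * Real.pi) hc
    have h2 : Complex.exp ((k : ℂ) * Complex.I * ((2 * Real.pi : ℝ) : ℂ)) = 1 := by
      rw [← Complex.exp_int_mul_two_pi_mul_I k]
      congr 1
      push_cast
      ring
    rw [h2] at h
    simp only [Complex.ofReal_zero, mul_zero, Complex.exp_zero, sub_self, zero_div] at h
    rw [← h]
    congr 1
    ext θ
    congr 1
    ring

/-- The generating function expansion of `e^{t cos θ} = e^{(t/2) z} e^{(t/2) / z}` as a double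
series in `z = e^{iθ}`. -/
theorem hasSum_exp_mul_cos (n : ℕ) (t θ : ℝ) :
    HasSum (fun ab : ℕ × ℕ =>
      ((t / 2 : ℝ) : ℂ) ^ ab.1 / (ab.1.factorial : ℂ) *
        (((t / 2 : ℝ) : ℂ) ^ ab.2 / (ab.2.factorial : ℂ)) *
        Complex.exp (((n + ab.1 - ab.2 : ℤ) : ℂ) * θ * Complex.I))
      (Complex.exp (n * θ * Complex.I) * Complex.exp ((t : ℂ) * Complex.cos θ)) := by
  set x : ℂ := ((t / 2 : ℝ) : ℂ) with hx
  have hexp : ∀ y : ℂ, HasSum (fun k : ℕ => y ^ k / (k.factorial : ℂ)) (Complex.exp y) := by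
    intro y
    rw [Complex.exp_eq_exp_ℂ]
    exact NormedSpace.expSeries_div_hasSum_exp y
  have h1 := hexp (x * Complex.exp (θ * Complex.I))
  have h2 := hexp (x * Complex.exp (-(θ * Complex.I)))
  have hprod : Summable fun ab : ℕ × ℕ =>
      (x * Complex.exp (θ * Complex.I)) ^ ab.1 / (ab.1.factorial : ℂ) *
        ((x * Complex.exp (-(θ * Complex.I))) ^ ab.2 / (ab.2.factorial : ℂ)) :=
    summable_mul_of_summable_norm
      (f := fun k : ℕ => (x * Complex.exp (θ * Complex.I)) ^ k / (k.factorial : ℂ))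
      (g := fun k : ℕ => (x * Complex.exp (-(θ * Complex.I))) ^ k / (k.factorial : ℂ))
      (NormedSpace.norm_expSeries_div_summable _) (NormedSpace.norm_expSeries_div_summable _)
  have h3 := (h1.mul h2 hprod).mul_left (Complex.exp (n * θ * Complex.I))
  have hval : Complex.exp (x * Complex.exp (θ * Complex.I)) *
      Complex.exp (x * Complex.exp (-(θ * Complex.I))) =
      Complex.exp ((t : ℂ) * Complex.cos θ) := by
    rw [← Complex.exp_add, Complex.cos, hx]
    push_cast
    ring_nf
  rw [hval] at h3
  refine Eq.mpr (congrArg (HasSum · _) (funext fun ab => ?_)) h3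
  have : Complex.exp (((n + ab.1 - ab.2 : ℤ) : ℂ) * θ * Complex.I) =
      Complex.exp (n * θ * Complex.I) * (Complex.exp (θ * Complex.I) ^ ab.1 *
        Complex.exp (-(θ * Complex.I)) ^ ab.2) := by
    rw [← Complex.exp_nat_mul, ← Complex.exp_nat_mul, ← Complex.exp_add, ← Complex.exp_add]
    congr 1
    push_cast
    ring
  rw [this, mul_pow, mul_pow]
  ring

/-- Bessel's integral `∫₀^{2π} e^{inθ} e^{t cos θ} dθ = 2π I_n(t)`. -/
theorem trigMoment_natCast (n : ℕ) (t : ℝ) :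
    trigMoment n t = 2 * Real.pi * (besselI n t : ℂ) := by
  set x : ℂ := ((t / 2 : ℝ) : ℂ) with hx
  let f : ℕ × ℕ → ℝ → ℂ := fun ab θ =>
    x ^ ab.1 / (ab.1.factorial : ℂ) * (x ^ ab.2 / (ab.2.factorial : ℂ)) *
      Complex.exp (((n + ab.1 - ab.2 : ℤ) : ℂ) * θ * Complex.I)
  have hfc : ∀ ab, Continuous (f ab) := by
    intro ab
    simp only [f]
    fun_prop
  have hnorm : ∀ ab θ, ‖f ab θ‖ =
      |t / 2| ^ ab.1 / (ab.1.factorial : ℝ) * (|t / 2| ^ ab.2 / (ab.2.factorial : ℝ)) := by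
    intro ab θ
    simp only [f, norm_mul, norm_div, norm_pow, Complex.norm_natCast]
    have : ‖Complex.exp (((n + ab.1 - ab.2 : ℤ) : ℂ) * θ * Complex.I)‖ = 1 := by
      have := Complex.norm_exp_ofReal_mul_I (((n + ab.1 - ab.2 : ℤ) : ℝ) * θ)
      push_cast at this ⊢
      exact this
    rw [this, mul_one, hx, Complex.norm_real, Real.norm_eq_abs]
  have hsr : Summable fun ab : ℕ × ℕ =>
      |t / 2| ^ ab.1 / (ab.1.factorial : ℝ) * (|t / 2| ^ ab.2 / (ab.2.factorial : ℝ)) :=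
    (Real.summable_pow_div_factorial |t / 2|).mul_of_nonneg
      (Real.summable_pow_div_factorial |t / 2|) (fun _ => by positivity) (fun _ => by positivity)
  have hsum : ∀ θ : ℝ, HasSum (fun ab => f ab θ)
      (Complex.exp (n * θ * Complex.I) * Complex.exp ((t : ℂ) * Complex.cos θ)) :=
    fun θ => hasSum_exp_mul_cos n t θ
  have hint : HasSum (fun ab => ∫ θ in (0 : ℝ)..2 * Real.pi, f ab θ) (trigMoment n t) :=
    intervalIntegral.hasSum_integral_of_dominated_convergence
      (fun ab _ => |t / 2| ^ ab.1 / (ab.1.factorial : ℝ) *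
        (|t / 2| ^ ab.2 / (ab.2.factorial : ℝ)))
      (fun ab => (hfc ab).aestronglyMeasurable)
      (fun ab => Filter.Eventually.of_forall fun θ _ => (hnorm ab θ).le)
      (Filter.Eventually.of_forall fun _ _ => hsr) (by simp)
      (Filter.Eventually.of_forall fun θ _ => hsum θ)
  have hval : ∀ ab : ℕ × ℕ, ∫ θ in (0 : ℝ)..2 * Real.pi, f ab θ =
      if (n : ℤ) + ab.1 - ab.2 = 0 then
        2 * Real.pi * (x ^ ab.1 / (ab.1.factorial : ℂ) * (x ^ ab.2 / (ab.2.factorial : ℂ)))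
      else 0 := by
    intro ab
    simp only [f]
    rw [intervalIntegral.integral_const_mul, integral_exp_int_mul_I]
    split_ifs <;> ring
  simp only [hval] at hint
  -- only the terms `(k, k + n)` survive integration
  have hinj : Function.Injective fun k : ℕ => (k, k + n) := fun a b h => (Prod.mk.inj h).1
  rw [← hinj.hasSum_iff] at hint
  · have h4 : HasSum (fun k : ℕ => (((t / 2) ^ (2 * k + n) /
        ((k.factorial : ℝ) * ((k + n).factorial : ℝ)) : ℝ) : ℂ))
        (trigMoment n t / (2 * Real.pi)) := by
      refine Eq.mpr (congrArg (HasSum · _) (funext fun k => ?_))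
        (hint.div_const (2 * Real.pi : ℂ))
      have hpi : (Real.pi : ℂ) ≠ 0 := by exact_mod_cast Real.pi_ne_zero
      simp only [Function.comp]
      rw [if_pos (by push_cast; ring), hx]
      push_cast
      field_simp
      ring
    have h5 := h4.tsum_eq
    rw [← Complex.ofReal_tsum] at h5
    have hpi : (Real.pi : ℂ) ≠ 0 := by exact_mod_cast Real.pi_ne_zero
    unfold besselI
    rw [h5]
    field_simp
  · rintro ⟨a, b⟩ hab
    rw [if_neg]
    intro h
    exact hab ⟨a, by ext <;> simp; omega⟩

/-- The `k`-th trigonometric moment `I_{|k|}(t)`, for `k ∈ ℤ`, of the weight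
`e^{t cos θ} / (2π)`. -/
def besselMoment (k : ℤ) (t : ℝ) : ℝ := besselI k.natAbs t

theorem besselMoment_neg (k : ℤ) (t : ℝ) : besselMoment (-k) t = besselMoment k t := by
  simp [besselMoment]

theorem trigMoment_neg (k : ℤ) (t : ℝ) :
    trigMoment (-k) t = (starRingEnd ℂ) (trigMoment k t) := by
  unfold trigMoment
  simp only [intervalIntegral.integral_of_le (show (0 : ℝ) ≤ 2 * Real.pi by positivity)]
  rw [← integral_conj]
  refine MeasureTheory.integral_congr_ae (Filter.Eventually.of_forall fun θ => ?_)
  simp only [map_mul, ← Complex.exp_conj, ← Complex.cos_conj, Complex.conj_ofReal, Complex.conj_I,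
    map_intCast]
  push_cast
  ring_nf

theorem trigMoment_eq (k : ℤ) (t : ℝ) :
    trigMoment k t = ((2 * Real.pi * besselMoment k t : ℝ) : ℂ) := by
  obtain ⟨n, rfl | rfl⟩ := k.eq_nat_or_neg
  · rw [trigMoment_natCast]
    simp [besselMoment]
  · rw [trigMoment_neg, trigMoment_natCast, besselMoment_neg]
    simp [besselMoment, -mul_eq_mul_left_iff, -mul_eq_mul_right_iff, Complex.conj_ofNat]

theorem hasDerivAt_trigMoment (k : ℤ) (t : ℝ) :
    HasDerivAt (trigMoment k) ((trigMoment (k + 1) t + trigMoment (k - 1) t) / 2) t := by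
  have h := (intervalIntegral.hasDerivAt_integral_of_dominated_loc_of_deriv_le
    (μ := MeasureTheory.volume) (a := 0) (b := 2 * Real.pi) (𝕜 := ℝ) (x₀ := t)
    (s := Metric.ball t 1) (bound := fun _ => Real.exp (|t| + 1))
    (F := fun s θ => Complex.exp (k * θ * Complex.I) * Complex.exp ((s : ℂ) * Complex.cos θ))
    (F' := fun s θ => Complex.exp (k * θ * Complex.I) *
      (Complex.exp ((s : ℂ) * Complex.cos θ) * Complex.cos θ))
    (Metric.ball_mem_nhds t one_pos) (Filter.Eventually.of_forall fun s =>
      (by fun_prop : Continuous _).aestronglyMeasurable)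
    ((by fun_prop : Continuous _).intervalIntegrable _ _)
    (by fun_prop : Continuous _).aestronglyMeasurable ?_ (by simp) ?_).2
  · refine h.congr_deriv ?_
    simp only [trigMoment]
    rw [← intervalIntegral.integral_add ((by fun_prop : Continuous _).intervalIntegrable _ _)
      ((by fun_prop : Continuous _).intervalIntegrable _ _), ← intervalIntegral.integral_div]
    congr 1
    ext θ
    have h1 : Complex.exp (((k + 1 : ℤ) : ℂ) * θ * Complex.I) =
        Complex.exp (k * θ * Complex.I) * Complex.exp (θ * Complex.I) := by
      rw [← Complex.exp_add]; congr 1; push_cast; ring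
    have h2 : Complex.exp (((k - 1 : ℤ) : ℂ) * θ * Complex.I) =
        Complex.exp (k * θ * Complex.I) * Complex.exp (-θ * Complex.I) := by
      rw [← Complex.exp_add]; congr 1; push_cast; ring
    rw [h1, h2]
    generalize Complex.exp ((t : ℂ) * Complex.cos θ) = E
    rw [Complex.cos]
    ring
  · refine Filter.Eventually.of_forall fun θ _ s hs => ?_
    rw [← Complex.ofReal_cos, ← Complex.ofReal_mul, ← Complex.ofReal_exp, norm_mul, norm_mul,
      Complex.norm_real, Complex.norm_real]
    have h1 : ‖Complex.exp (k * θ * Complex.I)‖ = 1 := by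
      have := Complex.norm_exp_ofReal_mul_I (k * θ)
      push_cast at this
      exact this
    have h2 : |s| ≤ |t| + 1 := by
      have h3 : |s - t| < 1 := hs
      have := abs_sub_abs_le_abs_sub s t
      linarith
    have h4 : s * Real.cos θ ≤ |t| + 1 := by
      refine (le_abs_self _).trans ?_
      rw [abs_mul]
      exact (mul_le_of_le_one_right (abs_nonneg _) (Real.abs_cos_le_one θ)).trans h2
    rw [h1, one_mul, Real.norm_eq_abs, Real.norm_eq_abs, abs_of_pos (Real.exp_pos _)]
    exact (mul_le_of_le_one_right (Real.exp_pos _).le (Real.abs_cos_le_one θ)).trans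
      (Real.exp_le_exp.2 h4)
  · refine Filter.Eventually.of_forall fun θ _ s _ => ?_
    have h1 : HasDerivAt (fun s : ℝ => (s : ℂ) * Complex.cos θ) (Complex.cos θ) s := by
      simpa using (Complex.ofRealCLM.hasDerivAt (x := s)).mul_const (Complex.cos (θ : ℂ))
    exact h1.cexp.const_mul _

theorem hasDerivAt_besselMoment (k : ℤ) (t : ℝ) :
    HasDerivAt (besselMoment k) ((besselMoment (k + 1) t + besselMoment (k - 1) t) / 2) t := by
  have h := Complex.reCLM.hasFDerivAt.comp_hasDerivAt t (hasDerivAt_trigMoment k t)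
  have h2 := h.div_const (2 * Real.pi)
  have hpi := Real.pi_ne_zero
  have hf : besselMoment k = fun s => (Complex.reCLM ∘ trigMoment k) s / (2 * Real.pi) := by
    ext s
    simp only [Function.comp, Complex.reCLM_apply, trigMoment_eq, Complex.ofReal_re]
    field_simp
  have hd : Complex.reCLM ((trigMoment (k + 1) t + trigMoment (k - 1) t) / 2) / (2 * Real.pi) =
      (besselMoment (k + 1) t + besselMoment (k - 1) t) / 2 := by
    simp only [Complex.reCLM_apply, trigMoment_eq]
    rw [← Complex.ofReal_add, show (2 : ℂ) = ((2 : ℝ) : ℂ) by simp, ← Complex.ofReal_div,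
      Complex.ofReal_re]
    field_simp
  rw [hd] at h2
  rw [hf]
  exact h2

/-- Integration by parts against the weight, equivalent to the three-term recurrence of the
modified Bessel functions. -/
theorem int_mul_besselMoment (k : ℤ) (t : ℝ) :
    k * besselMoment k t = t / 2 * (besselMoment (k - 1) t - besselMoment (k + 1) t) := by
  -- the exact derivative of `e^{ikθ} e^{t cos θ}` integrates to zero over a period
  let g : ℤ → ℝ → ℂ := fun k θ =>
    Complex.exp (k * θ * Complex.I) * Complex.exp ((t : ℂ) * Complex.cos θ)
  have hgc : ∀ k, Continuous (g k) := fun k => by simp only [g]; fun_prop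
  have hderiv : ∀ θ : ℝ, HasDerivAt (g k)
      (Complex.I * (k * g k θ + t / 2 * (g (k + 1) θ - g (k - 1) θ))) θ := by
    intro θ
    have h1 : HasDerivAt (fun z : ℂ => Complex.exp (k * z * Complex.I) *
        Complex.exp ((t : ℂ) * Complex.cos z))
        (Complex.exp (k * θ * Complex.I) * (k * Complex.I) *
          Complex.exp ((t : ℂ) * Complex.cos θ) + Complex.exp (k * θ * Complex.I) *
          (Complex.exp ((t : ℂ) * Complex.cos θ) * (t * -Complex.sin θ))) (θ : ℂ) := by
      refine HasDerivAt.mul ?_ ?_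
      · refine HasDerivAt.cexp ?_
        simpa using ((hasDerivAt_id (θ : ℂ)).const_mul (k : ℂ)).mul_const Complex.I
      · exact ((Complex.hasDerivAt_cos θ).const_mul (t : ℂ)).cexp
    convert h1.comp_ofReal using 1
    have h1 : Complex.exp (((k + 1 : ℤ) : ℂ) * θ * Complex.I) =
        Complex.exp (k * θ * Complex.I) * Complex.exp (θ * Complex.I) := by
      rw [← Complex.exp_add]; congr 1; push_cast; ring
    have h2 : Complex.exp (((k - 1 : ℤ) : ℂ) * θ * Complex.I) =
        Complex.exp (k * θ * Complex.I) * Complex.exp (-θ * Complex.I) := by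
      rw [← Complex.exp_add]; congr 1; push_cast; ring
    simp only [g, h1, h2]
    rw [show Complex.sin θ = (Complex.exp (-θ * Complex.I) - Complex.exp (θ * Complex.I)) *
      Complex.I / 2 from rfl]
    ring
  have hper : g k (2 * Real.pi) = g k 0 := by
    simp only [g]
    congr 1
    · rw [← Complex.exp_int_mul_two_pi_mul_I k |>.trans (by simp : (1 : ℂ) = Complex.exp
        (k * (0 : ℝ) * Complex.I))]
      congr 1
      push_cast
      ring
    · push_cast
      rw [Complex.cos_two_pi, Complex.cos_zero]
  have h := intervalIntegral.integral_eq_sub_of_hasDerivAt (a := 0) (b := 2 * Real.pi)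
    (fun θ _ => hderiv θ) ((by fun_prop : Continuous _).intervalIntegrable _ _)
  have hg : ∀ k, ∫ θ in (0 : ℝ)..2 * Real.pi, g k θ =
      ((2 * Real.pi * besselMoment k t : ℝ) : ℂ) := fun k => trigMoment_eq k t
  have hgi : ∀ k, IntervalIntegrable (g k) MeasureTheory.volume 0 (2 * Real.pi) :=
    fun k => (hgc k).intervalIntegrable _ _
  rw [hper, sub_self, intervalIntegral.integral_const_mul, intervalIntegral.integral_add
    ((hgi k).const_mul _) (((hgi _).sub (hgi _)).const_mul _), intervalIntegral.integral_const_mul,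
    intervalIntegral.integral_const_mul, intervalIntegral.integral_sub (hgi _) (hgi _), hg, hg, hg,
    mul_eq_zero, or_iff_right Complex.I_ne_zero] at h
  have h' : k * (2 * Real.pi * besselMoment k t) + t / 2 * (2 * Real.pi * besselMoment (k + 1) t -
      2 * Real.pi * besselMoment (k - 1) t) = 0 := by exact_mod_cast h
  have hpi := Real.pi_pos
  have h'' : (2 * Real.pi) * (k * besselMoment k t + t / 2 * (besselMoment (k + 1) t -
      besselMoment (k - 1) t)) = 0 := by linarith
  rcases mul_eq_zero.1 h'' with h3 | h3
  · linarith
  · linarith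

/-! ### Moments of real polynomials -/

/-- The moment functional `p ↦ (2π)⁻¹ ∫ p(e^{iθ}) e^{-ijθ} e^{t cos θ} dθ` on real polynomials,
i.e. the pairing with `z ^ j` for the unnormalized weight; `j` may be negative. -/
def momentFunctional (t : ℝ) (j : ℤ) : ℝ[X] →ₗ[ℝ] ℝ :=
  lsum fun i => LinearMap.toSpanSingleton ℝ ℝ (besselMoment (i - j) t)

theorem momentFunctional_monomial (t : ℝ) (j : ℤ) (i : ℕ) (a : ℝ) :
    momentFunctional t j (monomial i a) = a * besselMoment (i - j) t := by
  simp [momentFunctional, lsum_apply, sum_monomial_index]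

theorem momentFunctional_eq_sum (t : ℝ) (j : ℤ) {p : ℝ[X]} {n : ℕ} (hp : p.natDegree < n) :
    momentFunctional t j p = ∑ i ∈ Finset.range n, p.coeff i * besselMoment (i - j) t := by
  rw [momentFunctional, lsum_apply, sum_over_range' _ (by simp) n hp]
  simp

theorem momentFunctional_C_mul (t : ℝ) (j : ℤ) (a : ℝ) (p : ℝ[X]) :
    momentFunctional t j (C a * p) = a * momentFunctional t j p := by
  rw [← smul_eq_C_mul, map_smul, smul_eq_mul]

theorem momentFunctional_X_mul (t : ℝ) (j : ℤ) (p : ℝ[X]) :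
    momentFunctional t j (X * p) = momentFunctional t (j - 1) p := by
  induction p using Polynomial.induction_on' with
  | add p q hp hq => rw [mul_add, map_add, map_add, hp, hq]
  | monomial i a =>
    rw [X_mul_monomial, momentFunctional_monomial, momentFunctional_monomial]
    congr 2
    push_cast
    ring

/-- Integration by parts on the circle. -/
theorem momentFunctional_X_mul_derivative (t : ℝ) (j : ℤ) (p : ℝ[X]) :
    momentFunctional t j (X * derivative p) = j * momentFunctional t j p +
      t / 2 * (momentFunctional t (j + 1) p - momentFunctional t (j - 1) p) := by
  induction p using Polynomial.induction_on' with
  | add p q hp hq =>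
    rw [map_add, mul_add, map_add, hp, hq, map_add, map_add, map_add]
    ring
  | monomial i a =>
    have h : X * derivative (monomial i a) = monomial i (a * i) := by
      rcases i with _ | i
      · simp
      · rw [derivative_monomial, X_mul_monomial]; simp
    rw [h]
    simp only [momentFunctional_monomial]
    have h1 := int_mul_besselMoment (i - j) t
    rw [show (i : ℤ) - j - 1 = i - (j + 1) by ring,
      show (i : ℤ) - j + 1 = i - (j - 1) by ring] at h1
    push_cast at h1
    linear_combination a * h1

/-! ### The pairing of real polynomials -/

theorem circlePairing_add_left (t : ℝ) (p q r : ℂ[X]) :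
    circlePairing (besselWeight t) (p + q) r =
      circlePairing (besselWeight t) p r + circlePairing (besselWeight t) q r := by
  simp only [circlePairing_besselWeight]
  rw [← intervalIntegral.integral_add
    ((continuous_circlePairing_integrand t _ _).intervalIntegrable _ _)
    ((continuous_circlePairing_integrand t _ _).intervalIntegrable _ _)]
  congr 1
  funext θ
  rw [eval_add]
  ring

theorem circlePairing_add_right (t : ℝ) (p q r : ℂ[X]) :
    circlePairing (besselWeight t) p (q + r) =
      circlePairing (besselWeight t) p q + circlePairing (besselWeight t) p r :=
  (circleCore t).add_left q r p

theorem circlePairing_conj_symm (t : ℝ) (p q : ℂ[X]) :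
    (starRingEnd ℂ) (circlePairing (besselWeight t) p q) = circlePairing (besselWeight t) q p :=
  (circleCore t).conj_inner_symm p q

theorem circlePairing_C_mul_C_mul (t : ℝ) (a b : ℝ) (p q : ℂ[X]) :
    circlePairing (besselWeight t) (C (a : ℂ) * p) (C (b : ℂ) * q) =
      a * b * circlePairing (besselWeight t) p q := by
  simp only [circlePairing_besselWeight]
  rw [← intervalIntegral.integral_const_mul]
  congr 1
  funext θ
  simp only [eval_mul, eval_C, map_mul, Complex.conj_ofReal]
  ring

theorem circlePairing_X_pow (t : ℝ) (i j : ℕ) :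
    circlePairing (besselWeight t) (X ^ i) (X ^ j) =
      ((besselMoment (i - j) t / besselI 0 t : ℝ) : ℂ) := by
  have h := trigMoment_eq (i - j) t
  rw [circlePairing_besselWeight]
  have h2 : ∀ θ : ℝ, (eval (circleMap 0 1 θ) (X ^ i : ℂ[X]) *
      (starRingEnd ℂ) (eval (circleMap 0 1 θ) (X ^ j : ℂ[X]))) *
        ((1 / (2 * Real.pi * besselI 0 t) * Real.exp (t * Real.cos θ) : ℝ) : ℂ) =
      ((1 / (2 * Real.pi * besselI 0 t) : ℝ) : ℂ) *
        (Complex.exp (((i - j : ℤ) : ℂ) * θ * Complex.I) *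
          Complex.exp ((t : ℂ) * Complex.cos θ)) := by
    intro θ
    have h3 : Complex.exp (((i - j : ℤ) : ℂ) * θ * Complex.I) =
        Complex.exp (θ * Complex.I) ^ i * Complex.exp (-(θ * Complex.I)) ^ j := by
      rw [← Complex.exp_nat_mul, ← Complex.exp_nat_mul, ← Complex.exp_add]
      congr 1
      push_cast
      ring
    have h4 : (starRingEnd ℂ) (Complex.exp (θ * Complex.I)) = Complex.exp (-(θ * Complex.I)) := by
      rw [← Complex.exp_conj]
      simp
    simp only [eval_pow, eval_X, circleMap, zero_add, Complex.ofReal_one, one_mul, map_pow]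
    rw [h3, h4]
    push_cast
    ring
  simp only [h2]
  rw [intervalIntegral.integral_const_mul]
  have h5 : ∫ θ in (0 : ℝ)..2 * Real.pi, (Complex.exp (((i - j : ℤ) : ℂ) * θ * Complex.I) *
      Complex.exp ((t : ℂ) * Complex.cos θ)) = ((2 * Real.pi * besselMoment (i - j) t : ℝ) : ℂ) := h
  rw [h5, ← Complex.ofReal_mul, Complex.ofReal_inj]
  have := besselI_zero_pos t
  have := Real.pi_pos
  field_simp

theorem circlePairing_map_ofReal (t : ℝ) {p q : ℝ[X]} {n : ℕ} (hq : q.natDegree < n) :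
    circlePairing (besselWeight t) (p.map Complex.ofRealHom) (q.map Complex.ofRealHom) =
      (((∑ j ∈ Finset.range n, q.coeff j * momentFunctional t j p) / besselI 0 t : ℝ) : ℂ) := by
  have hsum : ∑ j ∈ Finset.range n, q.coeff j * momentFunctional t j p =
      q.sum fun j b => b * momentFunctional t j p := by
    rw [sum_over_range' _ (by simp) n hq]
  rw [hsum]
  clear hsum hq n
  induction q using Polynomial.induction_on' with
  | add q r hq hr =>
    rw [Polynomial.map_add, circlePairing_add_right, hq, hr, sum_add_index _ _ _ (by simp)
      (by intros; ring), add_div, Complex.ofReal_add]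
  | monomial j b =>
    rw [sum_monomial_index _ _ (by simp)]
    induction p using Polynomial.induction_on' with
    | add p r hp hr =>
      rw [Polynomial.map_add, circlePairing_add_left, hp, hr, map_add, ← Complex.ofReal_add]
      congr 1
      ring
    | monomial i a =>
      rw [map_monomial, map_monomial, ← C_mul_X_pow_eq_monomial, ← C_mul_X_pow_eq_monomial]
      rw [Complex.ofRealHom_eq_coe, Complex.ofRealHom_eq_coe, circlePairing_C_mul_C_mul,
        circlePairing_X_pow, momentFunctional_monomial]
      push_cast
      ring

/-- The pairing is positive definite, in terms of moments. -/
theorem sum_coeff_mul_momentFunctional_pos (t : ℝ) {p : ℝ[X]} {n : ℕ} (hp : p.natDegree < n)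
    (h0 : p ≠ 0) : 0 < ∑ j ∈ Finset.range n, p.coeff j * momentFunctional t j p := by
  have hI := besselI_zero_pos t
  have h := circlePairing_map_ofReal t (p := p) hp
  have h1 : 0 ≤ (circlePairing (besselWeight t) (p.map Complex.ofRealHom)
      (p.map Complex.ofRealHom)).re := (circleCore t).re_inner_nonneg _
  have h2 : circlePairing (besselWeight t) (p.map Complex.ofRealHom)
      (p.map Complex.ofRealHom) ≠ 0 := by
    intro h3
    have h4 := (circleCore t).definite _ h3
    exact h0 ((Polynomial.map_eq_zero _).1 h4)
  rw [h] at h1 h2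
  rw [Complex.ofReal_re] at h1
  have h5 : (∑ j ∈ Finset.range n, p.coeff j * momentFunctional t j p) / besselI 0 t ≠ 0 := by
    exact_mod_cast h2
  have h6 := lt_of_le_of_ne h1 h5.symm
  exact (div_pos_iff_of_pos_right hI).1 h6

/-- A polynomial of degree less than `n` is determined by its moments of index `0, …, n - 1`. -/
theorem eq_of_momentFunctional_eq (t : ℝ) {p q : ℝ[X]} {n : ℕ}
    (hp : ∀ i, n ≤ i → p.coeff i = q.coeff i)
    (h : ∀ j : ℕ, j < n → momentFunctional t j p = momentFunctional t j q) : p = q := by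
  by_contra hne
  have h0 : p - q ≠ 0 := sub_ne_zero.2 hne
  have hd : (p - q).natDegree < n := by
    rw [natDegree_lt_iff_degree_lt h0, degree_lt_iff_coeff_zero]
    intro i hi
    rw [coeff_sub, hp i hi, sub_self]
  have := sum_coeff_mul_momentFunctional_pos t hd h0
  rw [Finset.sum_eq_zero] at this
  · exact lt_irrefl _ this
  · intro j hj
    rw [map_sub, h j (Finset.mem_range.1 hj), sub_self, mul_zero]

/-! ### The Szegő recurrence -/

/-- The monic orthogonal polynomial `Φ_n` and its reversal `Φ_n^*`, for the weight `e^{t cos θ}`,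
constructed by the Szegő recurrence
`Φ_{n+1} = z Φ_n + r_{n+1} Φ_n^*`, `Φ_{n+1}^* = r_{n+1} z Φ_n + Φ_n^*`,
where `r_{n+1}` makes `Φ_{n+1}` orthogonal to `1`. All coefficients are real because the moments
are. -/
def szegoPair (t : ℝ) : ℕ → ℝ[X] × ℝ[X]
  | 0 => (1, 1)
  | n + 1 =>
    let r := -momentFunctional t (-1) (szegoPair t n).1 / momentFunctional t 0 (szegoPair t n).2
    (X * (szegoPair t n).1 + C r * (szegoPair t n).2,
      C r * (X * (szegoPair t n).1) + (szegoPair t n).2)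

/-- The monic orthogonal polynomial `Φ_n`. -/
def monicOPUC (n : ℕ) (t : ℝ) : ℝ[X] := (szegoPair t n).1

/-- The reversed polynomial `Φ_n^*(z) = z ^ n Φ_n(1/z)`. -/
def reversedOPUC (n : ℕ) (t : ℝ) : ℝ[X] := (szegoPair t n).2

/-- The squared norm of `Φ_n` for the unnormalized weight, as the moment of `Φ_n^*` against `1`. -/
def opucNorm (n : ℕ) (t : ℝ) : ℝ := momentFunctional t 0 (reversedOPUC n t)

/-- The reflection coefficient `r_n = Φ_n(0)`. -/
def reflectionCoeff (n : ℕ) (t : ℝ) : ℝ := (monicOPUC n t).coeff 0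

theorem monicOPUC_zero (t : ℝ) : monicOPUC 0 t = 1 := rfl

theorem reversedOPUC_zero (t : ℝ) : reversedOPUC 0 t = 1 := rfl

theorem reflectionCoeff_zero (t : ℝ) : reflectionCoeff 0 t = 1 := by
  simp [reflectionCoeff, monicOPUC_zero]

theorem reversedOPUC_coeff_zero (n : ℕ) (t : ℝ) : (reversedOPUC n t).coeff 0 = 1 := by
  induction n with
  | zero => simp [reversedOPUC_zero]
  | succ n ih =>
    rw [reversedOPUC] at ih ⊢
    rw [szegoPair]
    simp [ih]

theorem reflectionCoeff_succ (n : ℕ) (t : ℝ) :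
    reflectionCoeff (n + 1) t = -momentFunctional t (-1) (monicOPUC n t) / opucNorm n t := by
  have h := reversedOPUC_coeff_zero n t
  rw [reversedOPUC] at h
  rw [reflectionCoeff, monicOPUC, szegoPair]
  simp only [coeff_add, mul_coeff_zero, coeff_X_zero, zero_mul, zero_add, coeff_C_zero, h, mul_one]
  rfl

theorem monicOPUC_succ (n : ℕ) (t : ℝ) : monicOPUC (n + 1) t =
    X * monicOPUC n t + C (reflectionCoeff (n + 1) t) * reversedOPUC n t := by
  rw [reflectionCoeff_succ]
  rfl

theorem reversedOPUC_succ (n : ℕ) (t : ℝ) : reversedOPUC (n + 1) t =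
    C (reflectionCoeff (n + 1) t) * (X * monicOPUC n t) + reversedOPUC n t := by
  rw [reflectionCoeff_succ]
  rfl

theorem coeff_opuc_eq_zero_of_lt (n : ℕ) (t : ℝ) :
    ∀ i, n < i → (monicOPUC n t).coeff i = 0 ∧ (reversedOPUC n t).coeff i = 0 := by
  induction n with
  | zero =>
    intro i hi
    simp [monicOPUC_zero, reversedOPUC_zero, coeff_one, hi.ne']
  | succ n ih =>
    intro i hi
    obtain ⟨i, rfl⟩ : ∃ k, i = k + 1 := ⟨i - 1, by omega⟩
    have h1 := ih i (by omega)
    have h2 := ih (i + 1) (by omega)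
    simp [monicOPUC_succ, reversedOPUC_succ, coeff_X_mul, h1, h2]

theorem natDegree_monicOPUC_le (n : ℕ) (t : ℝ) : (monicOPUC n t).natDegree ≤ n :=
  natDegree_le_iff_coeff_eq_zero.2 fun i hi => (coeff_opuc_eq_zero_of_lt n t i hi).1

theorem natDegree_reversedOPUC_le (n : ℕ) (t : ℝ) : (reversedOPUC n t).natDegree ≤ n :=
  natDegree_le_iff_coeff_eq_zero.2 fun i hi => (coeff_opuc_eq_zero_of_lt n t i hi).2

theorem coeff_monicOPUC_self (n : ℕ) (t : ℝ) : (monicOPUC n t).coeff n = 1 := by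
  induction n with
  | zero => simp [monicOPUC_zero]
  | succ n ih =>
    simp [monicOPUC_succ, coeff_X_mul, ih, (coeff_opuc_eq_zero_of_lt n t (n + 1) (by omega)).2]

/-- Reversal turns the pairing with `z ^ j` into the pairing with `z ^ (n - j)`. -/
theorem momentFunctional_reversedOPUC (n : ℕ) (t : ℝ) (j : ℤ) :
    momentFunctional t j (reversedOPUC n t) = momentFunctional t (n - j) (monicOPUC n t) := by
  induction n generalizing j with
  | zero =>
    rw [reversedOPUC_zero, monicOPUC_zero, ← monomial_zero_one, momentFunctional_monomial,
      momentFunctional_monomial, ← besselMoment_neg]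
    simp
  | succ n ih =>
    rw [reversedOPUC_succ, monicOPUC_succ, map_add, map_add, momentFunctional_C_mul,
      momentFunctional_C_mul, momentFunctional_X_mul, momentFunctional_X_mul, ih, ih]
    push_cast
    rw [show (n : ℤ) - (n + 1 - j) = j - 1 by ring, show (n : ℤ) + 1 - j - 1 = n - j by ring]
    ring

theorem momentFunctional_monicOPUC_self (n : ℕ) (t : ℝ) :
    momentFunctional t n (monicOPUC n t) = opucNorm n t := by
  rw [opucNorm, momentFunctional_reversedOPUC, sub_zero]

/-- Orthogonality identifies `opucNorm` with `⟨Φ_n, Φ_n⟩`, which is positive. -/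
theorem opucNorm_pos_of_orthogonal (n : ℕ) (t : ℝ)
    (h : ∀ j : ℕ, j < n → momentFunctional t j (monicOPUC n t) = 0) : 0 < opucNorm n t := by
  have h0 : monicOPUC n t ≠ 0 := by
    intro h0
    have := coeff_monicOPUC_self n t
    simp [h0] at this
  have h1 := sum_coeff_mul_momentFunctional_pos t
    (Nat.lt_succ_of_le (natDegree_monicOPUC_le n t)) h0
  rw [Finset.sum_range_succ, Finset.sum_eq_zero, zero_add, coeff_monicOPUC_self, one_mul,
    momentFunctional_monicOPUC_self] at h1
  · exact h1
  · intro j hj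
    rw [h j (Finset.mem_range.1 hj), mul_zero]

/-- `Φ_n` is orthogonal to `1, …, z ^ (n - 1)`. Orthogonality at step `n` makes the denominator of
`r_{n+1}` nonzero, which then gives orthogonality at step `n + 1`. -/
theorem momentFunctional_monicOPUC_of_lt (n : ℕ) (t : ℝ) :
    ∀ j : ℕ, j < n → momentFunctional t j (monicOPUC n t) = 0 := by
  induction n with
  | zero => intro j hj; omega
  | succ n ih =>
    have hpos := opucNorm_pos_of_orthogonal n t ih
    intro j hj
    rw [monicOPUC_succ, map_add, momentFunctional_C_mul, momentFunctional_X_mul]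
    rcases j with _ | j
    · rw [Nat.cast_zero, zero_sub, reflectionCoeff_succ]
      change _ + _ * opucNorm n t = 0
      field_simp
      ring
    · rw [momentFunctional_reversedOPUC]
      push_cast
      rw [add_sub_cancel_right, ih j (by omega),
        show (n : ℤ) - (j + 1) = ((n - (j + 1) : ℕ) : ℤ) by omega, ih _ (by omega)]
      ring

theorem opucNorm_pos (n : ℕ) (t : ℝ) : 0 < opucNorm n t :=
  opucNorm_pos_of_orthogonal n t (momentFunctional_monicOPUC_of_lt n t)

theorem momentFunctional_neg_one_monicOPUC (n : ℕ) (t : ℝ) :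
    momentFunctional t (-1) (monicOPUC n t) = -(reflectionCoeff (n + 1) t * opucNorm n t) := by
  have := opucNorm_pos n t
  rw [reflectionCoeff_succ]
  field_simp

theorem opucNorm_succ (n : ℕ) (t : ℝ) :
    opucNorm (n + 1) t = opucNorm n t * (1 - reflectionCoeff (n + 1) t ^ 2) := by
  rw [opucNorm, reversedOPUC_succ, map_add, momentFunctional_C_mul, momentFunctional_X_mul,
    zero_sub, momentFunctional_neg_one_monicOPUC]
  change _ + opucNorm n t = _
  ring

theorem one_sub_reflectionCoeff_sq_pos (n : ℕ) (t : ℝ) :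
    0 < 1 - reflectionCoeff (n + 1) t ^ 2 := by
  have h1 := opucNorm_pos n t
  have h2 := opucNorm_pos (n + 1) t
  rw [opucNorm_succ] at h2
  exact (mul_pos_iff_of_pos_left h1).1 h2

theorem momentFunctional_reversedOPUC_of_lt (n j : ℕ) (t : ℝ) (hj : j < n) :
    momentFunctional t (j + 1) (reversedOPUC n t) = 0 := by
  rw [momentFunctional_reversedOPUC, show (n : ℤ) - (j + 1) = ((n - (j + 1) : ℕ) : ℤ) by omega]
  exact momentFunctional_monicOPUC_of_lt n t _ (by omega)

theorem opucNorm_zero (t : ℝ) : opucNorm 0 t = besselI 0 t := by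
  rw [opucNorm, reversedOPUC_zero, ← monomial_zero_one, momentFunctional_monomial]
  simp [besselMoment]

theorem reflectionCoeff_one (t : ℝ) : reflectionCoeff 1 t = -(besselI 1 t / besselI 0 t) := by
  rw [reflectionCoeff_succ, opucNorm_zero, monicOPUC_zero, ← monomial_zero_one,
    momentFunctional_monomial]
  simp [besselMoment, neg_div]

/-! ### Identification of the orthonormal polynomials -/

theorem circlePairing_monicOPUC (m n : ℕ) (t : ℝ) (hmn : m ≤ n) :
    circlePairing (besselWeight t) ((monicOPUC n t).map Complex.ofRealHom)
      ((monicOPUC m t).map Complex.ofRealHom) =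
      if m = n then ((opucNorm n t / besselI 0 t : ℝ) : ℂ) else 0 := by
  rw [circlePairing_map_ofReal t (Nat.lt_succ_of_le (natDegree_monicOPUC_le m t)),
    Finset.sum_range_succ, Finset.sum_eq_zero, zero_add, coeff_monicOPUC_self, one_mul]
  · split_ifs with h
    · rw [h, momentFunctional_monicOPUC_self]
    · rw [momentFunctional_monicOPUC_of_lt n t m (by omega)]
      simp
  · intro j hj
    rw [momentFunctional_monicOPUC_of_lt n t j (by have := Finset.mem_range.1 hj; omega), mul_zero]

theorem isOPUC_monicOPUC (t : ℝ) : IsOPUC (besselWeight t) fun n =>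
    C ((√(besselI 0 t / opucNorm n t) : ℝ) : ℂ) * (monicOPUC n t).map Complex.ofRealHom := by
  have hI := besselI_zero_pos t
  have hpos : ∀ n, 0 < √(besselI 0 t / opucNorm n t) := fun n =>
    Real.sqrt_pos.2 (div_pos hI (opucNorm_pos n t))
  have hdeg : ∀ n, (C ((√(besselI 0 t / opucNorm n t) : ℝ) : ℂ) *
      (monicOPUC n t).map Complex.ofRealHom).natDegree = n := by
    intro n
    rw [natDegree_C_mul (by exact_mod_cast (hpos n).ne'), natDegree_map]
    refine le_antisymm (natDegree_monicOPUC_le n t) (le_natDegree_of_ne_zero ?_)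
    rw [coeff_monicOPUC_self]
    exact one_ne_zero
  have hlead : ∀ n, (C ((√(besselI 0 t / opucNorm n t) : ℝ) : ℂ) *
      (monicOPUC n t).map Complex.ofRealHom).leadingCoeff =
        ((√(besselI 0 t / opucNorm n t) : ℝ) : ℂ) := by
    intro n
    rw [leadingCoeff, hdeg, coeff_C_mul, coeff_map, coeff_monicOPUC_self]
    simp
  have horth : ∀ m n, m ≤ n → circlePairing (besselWeight t)
      (C ((√(besselI 0 t / opucNorm n t) : ℝ) : ℂ) * (monicOPUC n t).map Complex.ofRealHom)
      (C ((√(besselI 0 t / opucNorm m t) : ℝ) : ℂ) * (monicOPUC m t).map Complex.ofRealHom) =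
        if m = n then 1 else 0 := by
    intro m n hmn
    rw [circlePairing_C_mul_C_mul, circlePairing_monicOPUC m n t hmn]
    split_ifs with h
    · subst h
      have h1 := opucNorm_pos m t
      have h2 : √(besselI 0 t / opucNorm m t) * √(besselI 0 t / opucNorm m t) *
          (opucNorm m t / besselI 0 t) = 1 := by
        rw [Real.mul_self_sqrt (div_pos hI h1).le]
        field_simp
      exact_mod_cast h2
    · simp
  refine ⟨hdeg, fun n => ?_, fun n => ?_, fun m n => ?_⟩
  · rw [hlead, Complex.ofReal_re]
    exact hpos n
  · rw [hlead, Complex.ofReal_im]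
  · rcases le_total m n with h | h
    · rw [← circlePairing_conj_symm, horth m n h]
      split_ifs <;> simp
    · rw [horth n m h]
      simp only [eq_comm]

theorem besselOPUC_eq (t : ℝ) (n : ℕ) : besselOPUC t n =
    C ((√(besselI 0 t / opucNorm n t) : ℝ) : ℂ) * (monicOPUC n t).map Complex.ofRealHom :=
  congrFun (isOPUC_unique t (besselOPUC_isOPUC t) (isOPUC_monicOPUC t)) n

theorem besselKappa_eq (n : ℕ) (t : ℝ) : besselKappa n t = √(besselI 0 t / opucNorm n t) := by
  rw [besselKappa, leadingCoeff, (besselOPUC_isOPUC t).natDegree_eq, besselOPUC_eq, coeff_C_mul,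
    coeff_map, coeff_monicOPUC_self]
  simp

theorem besselPhi_eq (n : ℕ) (t : ℝ) (z : ℂ) :
    besselPhi n t z = besselKappa n t * ((monicOPUC n t).map Complex.ofRealHom).eval z := by
  rw [besselPhi, besselOPUC_eq, ← besselKappa_eq, eval_C_mul]

/-! ### Dependence on the parameter -/

/-- Coefficientwise differentiability of a one-parameter family of polynomials. -/
def HasCoeffDerivAt (p : ℝ → ℝ[X]) (p' : ℝ[X]) (t : ℝ) : Prop :=
  ∀ i, HasDerivAt (fun s => (p s).coeff i) (p'.coeff i) t

theorem HasCoeffDerivAt.add {p q : ℝ → ℝ[X]} {p' q' : ℝ[X]} {t : ℝ}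
    (hp : HasCoeffDerivAt p p' t) (hq : HasCoeffDerivAt q q' t) :
    HasCoeffDerivAt (fun s => p s + q s) (p' + q') t := by
  intro i
  simp only [coeff_add]
  exact (hp i).add (hq i)

theorem HasCoeffDerivAt.C_mul {p : ℝ → ℝ[X]} {p' : ℝ[X]} {a : ℝ → ℝ} {a' : ℝ} {t : ℝ}
    (ha : HasDerivAt a a' t) (hp : HasCoeffDerivAt p p' t) :
    HasCoeffDerivAt (fun s => C (a s) * p s) (C a' * p t + C (a t) * p') t := by
  intro i
  simp only [coeff_add, coeff_C_mul]
  exact ha.mul (hp i)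

theorem HasCoeffDerivAt.X_mul {p : ℝ → ℝ[X]} {p' : ℝ[X]} {t : ℝ}
    (hp : HasCoeffDerivAt p p' t) : HasCoeffDerivAt (fun s => X * p s) (X * p') t := by
  intro i
  rcases i with _ | i
  · simpa using hasDerivAt_const t (0 : ℝ)
  · simp only [coeff_X_mul]
    exact hp i

theorem HasCoeffDerivAt.coeff_eq_zero {p : ℝ → ℝ[X]} {p' : ℝ[X]} {t a : ℝ} {i : ℕ}
    (hp : HasCoeffDerivAt p p' t) (h : ∀ s, (p s).coeff i = a) : p'.coeff i = 0 := by
  have h1 := hp i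
  simp only [h] at h1
  exact h1.unique (hasDerivAt_const t a)

theorem HasCoeffDerivAt.natDegree_le {p : ℝ → ℝ[X]} {p' : ℝ[X]} {t : ℝ} {n : ℕ}
    (hp : HasCoeffDerivAt p p' t) (hn : ∀ s, (p s).natDegree ≤ n) : p'.natDegree ≤ n :=
  natDegree_le_iff_coeff_eq_zero.2 fun _ hi =>
    hp.coeff_eq_zero fun s => coeff_eq_zero_of_natDegree_lt ((hn s).trans_lt hi)

/-- The weight contributes a factor `cos θ = (z + z⁻¹) / 2` to the derivative of a moment. -/
theorem HasCoeffDerivAt.momentFunctional {p : ℝ → ℝ[X]} {p' : ℝ[X]} {t : ℝ} {n : ℕ}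
    (hp : HasCoeffDerivAt p p' t) (hn : ∀ s, (p s).natDegree ≤ n) (j : ℤ) :
    HasDerivAt (fun s => momentFunctional s j (p s)) (momentFunctional t j p' +
      (momentFunctional t (j + 1) (p t) + momentFunctional t (j - 1) (p t)) / 2) t := by
  have h1 : ∀ s j, _root_.momentFunctional s j (p s) =
      ∑ i ∈ Finset.range (n + 1), (p s).coeff i * besselMoment (i - j) s :=
    fun s j => momentFunctional_eq_sum s j (Nat.lt_succ_of_le (hn s))
  simp only [h1]
  rw [momentFunctional_eq_sum t j (Nat.lt_succ_of_le (hp.natDegree_le hn))]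
  refine (HasDerivAt.fun_sum fun i _ =>
    (hp i).mul (hasDerivAt_besselMoment (i - j) t)).congr_deriv ?_
  rw [← Finset.sum_add_distrib, Finset.sum_div, ← Finset.sum_add_distrib]
  refine Finset.sum_congr rfl fun i _ => ?_
  rw [show (i : ℤ) - (j + 1) = i - j - 1 by ring, show (i : ℤ) - (j - 1) = i - j + 1 by ring]
  ring

theorem HasCoeffDerivAt.eval {p : ℝ → ℝ[X]} {p' : ℝ[X]} {t : ℝ} {n : ℕ}
    (hp : HasCoeffDerivAt p p' t) (hn : ∀ s, (p s).natDegree ≤ n) (z : ℂ) :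
    HasDerivAt (fun s => ((p s).map Complex.ofRealHom).eval z)
      ((p'.map Complex.ofRealHom).eval z) t := by
  have h1 : ∀ q : ℝ[X], q.natDegree ≤ n → (q.map Complex.ofRealHom).eval z =
      ∑ i ∈ Finset.range (n + 1), (q.coeff i : ℂ) * z ^ i := by
    intro q hq
    rw [eval_eq_sum_range' (n := n + 1) ((natDegree_map_le).trans_lt (Nat.lt_succ_of_le hq))]
    simp
  rw [h1 p' (hp.natDegree_le hn)]
  simp only [fun s => h1 (p s) (hn s)]
  exact HasDerivAt.fun_sum fun i _ => (hp i).ofReal_comp.mul_const (z ^ i)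

theorem exists_hasCoeffDerivAt (n : ℕ) (t : ℝ) :
    (∃ p', HasCoeffDerivAt (monicOPUC n) p' t) ∧ ∃ q', HasCoeffDerivAt (reversedOPUC n) q' t := by
  induction n with
  | zero =>
    refine ⟨⟨0, fun i => ?_⟩, ⟨0, fun i => ?_⟩⟩
    · simpa only [monicOPUC_zero, coeff_zero] using hasDerivAt_const t _
    · simpa only [reversedOPUC_zero, coeff_zero] using hasDerivAt_const t _
  | succ n ih =>
    obtain ⟨⟨p', hp⟩, ⟨q', hq⟩⟩ := ih
    have h1 := hp.momentFunctional (fun s => natDegree_monicOPUC_le n s) (-1)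
    have h2 := hq.momentFunctional (fun s => natDegree_reversedOPUC_le n s) 0
    have h3 := h1.fun_neg.fun_div h2 (opucNorm_pos n t).ne'
    have h4 : reflectionCoeff (n + 1) = fun s =>
        -momentFunctional s (-1) (monicOPUC n s) / momentFunctional s 0 (reversedOPUC n s) :=
      funext fun s => reflectionCoeff_succ n s
    rw [← h4] at h3
    constructor
    · rw [funext fun s => monicOPUC_succ n s]
      exact ⟨_, hp.X_mul.add (hq.C_mul h3)⟩
    · rw [funext fun s => reversedOPUC_succ n s]
      exact ⟨_, (hp.X_mul.C_mul h3).add hq⟩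

theorem momentFunctional_monicOPUC_of_le (n j : ℕ) (t : ℝ) (hj : j ≤ n) :
    momentFunctional t j (monicOPUC n t) = if j = n then opucNorm n t else 0 := by
  split_ifs with h
  · rw [h, momentFunctional_monicOPUC_self]
  · exact momentFunctional_monicOPUC_of_lt n t j (by omega)

theorem momentFunctional_reversedOPUC_of_le (n j : ℕ) (t : ℝ) (hj : j ≤ n) :
    momentFunctional t j (reversedOPUC n t) = if j = 0 then opucNorm n t else 0 := by
  rcases j with _ | j
  · rfl
  · exact_mod_cast momentFunctional_reversedOPUC_of_lt n j t (by omega)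

theorem momentFunctional_sub_one_monicOPUC (n j : ℕ) (t : ℝ) (hj : j ≤ n) :
    momentFunctional t (j - 1) (monicOPUC n t) =
      if j = 0 then -(reflectionCoeff (n + 1) t * opucNorm n t) else 0 := by
  rcases j with _ | j
  · simpa using momentFunctional_neg_one_monicOPUC n t
  · simpa using momentFunctional_monicOPUC_of_lt n t j (by omega)

theorem momentFunctional_add_one_monicOPUC (n j : ℕ) (t : ℝ) (hj : j ≤ n) :
    momentFunctional t (j + 1) (monicOPUC (n + 1) t) =
      if j = n then opucNorm n t * (1 - reflectionCoeff (n + 1) t ^ 2) else 0 := by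
  have h := momentFunctional_monicOPUC_of_le (n + 1) (j + 1) t (by omega)
  rw [opucNorm_succ] at h
  simpa using h

/-- The derivative of `Φ_{n+1}` in the parameter: differentiating the orthogonality relations
shows that it has degree at most `n` and only its moments of index `0` and `n` can be nonzero,
like a combination of `Φ_n` and `Φ_n^*`. -/
theorem hasCoeffDerivAt_monicOPUC (n : ℕ) (t : ℝ) :
    HasCoeffDerivAt (monicOPUC (n + 1)) (C ((1 - reflectionCoeff (n + 1) t ^ 2) / 2) *
      (C (reflectionCoeff (n + 2) t) * reversedOPUC n t - monicOPUC n t)) t := by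
  obtain ⟨p', hp⟩ := (exists_hasCoeffDerivAt (n + 1) t).1
  suffices h : p' = C ((1 - reflectionCoeff (n + 1) t ^ 2) / 2) *
      (C (reflectionCoeff (n + 2) t) * reversedOPUC n t - monicOPUC n t) by rwa [← h]
  refine eq_of_momentFunctional_eq t (n := n + 1) (fun i hi => ?_) fun j hj => ?_
  · have h1 := coeff_opuc_eq_zero_of_lt n t i (by omega)
    simp only [coeff_C_mul, coeff_sub, h1, mul_zero, sub_zero]
    rcases hi.eq_or_lt with rfl | hi
    · exact hp.coeff_eq_zero fun s => coeff_monicOPUC_self (n + 1) s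
    · exact hp.coeff_eq_zero fun s => (coeff_opuc_eq_zero_of_lt (n + 1) s i hi).1
  · have h1 := hp.momentFunctional (fun s => natDegree_monicOPUC_le (n + 1) s) j
    simp only [fun s => momentFunctional_monicOPUC_of_lt (n + 1) s j hj] at h1
    have h2 := h1.unique (hasDerivAt_const t 0)
    rw [momentFunctional_add_one_monicOPUC n j t (by omega),
      momentFunctional_sub_one_monicOPUC (n + 1) j t (by omega), opucNorm_succ] at h2
    rw [momentFunctional_C_mul, map_sub, momentFunctional_C_mul,
      momentFunctional_reversedOPUC_of_le n j t (by omega),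
      momentFunctional_monicOPUC_of_le n j t (by omega)]
    split_ifs at h2 ⊢ <;> linear_combination h2

/-- The derivative of `Φ_{n+1}` in `z`, by the same moment argument after integrating by parts. -/
theorem X_mul_derivative_monicOPUC (n : ℕ) (t : ℝ) :
    X * derivative (monicOPUC (n + 1) t) - C ((n : ℝ) + 1) * monicOPUC (n + 1) t =
      C (t / 2 * (1 - reflectionCoeff (n + 1) t ^ 2)) *
        (C (reflectionCoeff (n + 2) t) * reversedOPUC n t + monicOPUC n t) := by
  refine eq_of_momentFunctional_eq t (n := n + 1) (fun i hi => ?_) fun j hj => ?_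
  · have h1 := coeff_opuc_eq_zero_of_lt n t i (by omega)
    obtain ⟨i, rfl⟩ : ∃ k, i = k + 1 := ⟨i - 1, by omega⟩
    simp only [coeff_C_mul, coeff_sub, coeff_add, h1, mul_zero, add_zero, coeff_X_mul,
      coeff_derivative]
    rcases hi.eq_or_lt with h | hi
    · obtain rfl : n = i := by omega
      ring
    · rw [(coeff_opuc_eq_zero_of_lt (n + 1) t (i + 1) hi).1]
      ring
  · rw [map_sub, momentFunctional_X_mul_derivative, momentFunctional_C_mul,
      momentFunctional_monicOPUC_of_lt (n + 1) t j hj,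
      momentFunctional_add_one_monicOPUC n j t (by omega),
      momentFunctional_sub_one_monicOPUC (n + 1) j t (by omega), opucNorm_succ,
      momentFunctional_C_mul, map_add, momentFunctional_C_mul,
      momentFunctional_reversedOPUC_of_le n j t (by omega),
      momentFunctional_monicOPUC_of_le n j t (by omega)]
    split_ifs <;> ring

theorem hasDerivAt_reflectionCoeff (n : ℕ) (t : ℝ) :
    HasDerivAt (reflectionCoeff (n + 1)) ((1 - reflectionCoeff (n + 1) t ^ 2) / 2 *
      (reflectionCoeff (n + 2) t - reflectionCoeff n t)) t := by
  have h := hasCoeffDerivAt_monicOPUC n t 0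
  rw [coeff_C_mul, coeff_sub, coeff_C_mul, reversedOPUC_coeff_zero, mul_one] at h
  exact h

/-- The discrete Painlevé II equation. -/
theorem discretePainleve_reflectionCoeff (n : ℕ) (t : ℝ) :
    -(((n : ℝ) + 1) * reflectionCoeff (n + 1) t) =
      t / 2 * (1 - reflectionCoeff (n + 1) t ^ 2) *
        (reflectionCoeff (n + 2) t + reflectionCoeff n t) := by
  have h := congrArg (coeff · 0) (X_mul_derivative_monicOPUC n t)
  simp only [coeff_sub, coeff_add, mul_coeff_zero, coeff_X_zero, zero_mul, zero_sub,
    reversedOPUC_coeff_zero, mul_one, coeff_C_zero] at h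
  exact h

/-! ### Nonvanishing of the reflection coefficients -/

/-- Eliminating `r_{n+2}` between the differential and the difference equation gives
`(d/dt) ((-t) ^ (n+1) r_{n+1}) = t (1 - r_{n+1}²) ((-t) ^ n r_n)`. -/
theorem hasDerivAt_neg_pow_mul_reflectionCoeff (n : ℕ) (t : ℝ) :
    HasDerivAt (fun s => (-s) ^ (n + 1) * reflectionCoeff (n + 1) s)
      (t * (1 - reflectionCoeff (n + 1) t ^ 2) * ((-t) ^ n * reflectionCoeff n t)) t := by
  have h1 : HasDerivAt (fun s : ℝ => (-s) ^ (n + 1)) (((n : ℝ) + 1) * (-t) ^ n * (-1)) t := by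
    simpa using (hasDerivAt_neg t).fun_pow (n + 1)
  refine (h1.mul (hasDerivAt_reflectionCoeff n t)).congr_deriv ?_
  have h2 := discretePainleve_reflectionCoeff n t
  rw [pow_succ]
  linear_combination (-t) ^ n * h2

/-- For `t ≠ 0` the reflection coefficients alternate in sign (`t > 0`) or are positive (`t < 0`). -/
theorem neg_pow_mul_reflectionCoeff_pos (n : ℕ) {t : ℝ} (ht : t ≠ 0) :
    0 < (-t) ^ n * reflectionCoeff n t := by
  induction n generalizing t with
  | zero => simp [reflectionCoeff_zero]
  | succ n ih =>
    have hd := hasDerivAt_neg_pow_mul_reflectionCoeff n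
    have hc : Continuous fun s => (-s) ^ (n + 1) * reflectionCoeff (n + 1) s :=
      continuous_iff_continuousAt.2 fun s => (hd s).continuousAt
    have h0 : (-(0 : ℝ)) ^ (n + 1) * reflectionCoeff (n + 1) 0 = 0 := by simp
    rcases ht.lt_or_gt with h | h
    · have hanti : StrictAntiOn (fun s => (-s) ^ (n + 1) * reflectionCoeff (n + 1) s)
          (Set.Iic 0) := by
        refine strictAntiOn_of_deriv_neg (convex_Iic 0) hc.continuousOn fun s hs => ?_
        rw [interior_Iic] at hs
        rw [(hd s).deriv]
        exact mul_neg_of_neg_of_pos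
          (mul_neg_of_neg_of_pos hs (one_sub_reflectionCoeff_sq_pos n s)) (ih (ne_of_lt hs))
      have := hanti h.le (Set.self_mem_Iic (a := (0 : ℝ))) h
      simpa only [h0] using this
    · have hmono : StrictMonoOn (fun s => (-s) ^ (n + 1) * reflectionCoeff (n + 1) s)
          (Set.Ici 0) := by
        refine strictMonoOn_of_deriv_pos (convex_Ici 0) hc.continuousOn fun s hs => ?_
        rw [interior_Ici] at hs
        rw [(hd s).deriv]
        exact mul_pos (mul_pos hs (one_sub_reflectionCoeff_sq_pos n s)) (ih (ne_of_gt hs))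
      have := hmono (Set.self_mem_Ici (a := (0 : ℝ))) h.le h
      simpa only [h0] using this

theorem reflectionCoeff_ne_zero (n : ℕ) {t : ℝ} (ht : t ≠ 0) : reflectionCoeff n t ≠ 0 :=
  right_ne_zero_of_mul (neg_pow_mul_reflectionCoeff_pos n ht).ne'

/-! ### The differential relations -/

theorem hasDerivAt_besselI_zero (t : ℝ) : HasDerivAt (besselI 0) (besselI 1 t) t := by
  have h := hasDerivAt_besselMoment 0 t
  refine h.congr_deriv ?_
  simp [besselMoment]

theorem hasDerivAt_opucNorm (n : ℕ) (t : ℝ) :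
    HasDerivAt (opucNorm n)
      (-(reflectionCoeff n t * reflectionCoeff (n + 1) t * opucNorm n t)) t := by
  induction n with
  | zero =>
    have hI := besselI_zero_pos t
    rw [opucNorm_zero, funext opucNorm_zero, reflectionCoeff_zero, reflectionCoeff_one]
    refine (hasDerivAt_besselI_zero t).congr_deriv ?_
    field_simp
  | succ n ih =>
    rw [opucNorm_succ, funext fun s => opucNorm_succ n s]
    refine (ih.mul (((hasDerivAt_reflectionCoeff n t).fun_pow 2).const_sub 1)).congr_deriv ?_
    push_cast
    ring

theorem besselKappa_pos (n : ℕ) (t : ℝ) : 0 < besselKappa n t :=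
  (besselOPUC_isOPUC t).leadingCoeff_re_pos n

theorem hasDerivAt_besselKappa (n : ℕ) (t : ℝ) :
    HasDerivAt (besselKappa n) (besselKappa n t / 2 * (besselI 1 t / besselI 0 t +
      reflectionCoeff n t * reflectionCoeff (n + 1) t)) t := by
  have hI := besselI_zero_pos t
  have hh := opucNorm_pos n t
  have hk := besselKappa_pos n t
  have hsq : besselKappa n t ^ 2 = besselI 0 t / opucNorm n t := by
    rw [besselKappa_eq, Real.sq_sqrt (div_pos hI hh).le]
  have h := ((hasDerivAt_besselI_zero t).fun_div (hasDerivAt_opucNorm n t) hh.ne').sqrt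
    (div_pos hI hh).ne'
  have hfun : besselKappa n = fun s => √(besselI 0 s / opucNorm n s) :=
    funext fun s => besselKappa_eq n s
  rw [← hfun, ← besselKappa_eq] at h
  refine h.congr_deriv ?_
  field_simp at hsq ⊢
  rw [hsq]
  ring

theorem besselKappa_sq_succ (n : ℕ) (t : ℝ) :
    besselKappa (n + 1) t ^ 2 * (1 - reflectionCoeff (n + 1) t ^ 2) = besselKappa n t ^ 2 := by
  have hI := besselI_zero_pos t
  have hh := opucNorm_pos n t
  have h1 := one_sub_reflectionCoeff_sq_pos n t
  rw [besselKappa_eq, besselKappa_eq, Real.sq_sqrt (div_pos hI (opucNorm_pos _ t)).le,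
    Real.sq_sqrt (div_pos hI hh).le, opucNorm_succ]
  field_simp

theorem besselPhi_zero_right (n : ℕ) (t : ℝ) :
    besselPhi n t 0 = besselKappa n t * reflectionCoeff n t := by
  rw [besselPhi_eq, ← coeff_zero_eq_eval_zero, coeff_map]
  rfl

theorem besselPhi_zero_left (t : ℝ) (z : ℂ) : besselPhi 0 t z = 1 := by
  have hI := besselI_zero_pos t
  rw [besselPhi_eq, besselKappa_eq, opucNorm_zero, monicOPUC_zero, div_self hI.ne']
  simp

theorem hasDerivAt_besselPhi (n : ℕ) (t : ℝ) (ht : t ≠ 0) (z : ℂ) :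
    HasDerivAt (fun s => besselPhi (n + 1) s z)
      ((((besselI 1 t : ℂ) / (besselI 0 t : ℂ) +
            besselPhi (n + 2) t 0 / (besselKappa (n + 2) t : ℂ) *
              ((besselKappa (n + 1) t : ℂ) / besselPhi (n + 1) t 0)) * besselPhi (n + 1) t z -
          (besselKappa n t : ℂ) / (besselKappa (n + 1) t : ℂ) *
            (1 + besselPhi (n + 2) t 0 / (besselKappa (n + 2) t : ℂ) *
              ((besselKappa (n + 1) t : ℂ) / besselPhi (n + 1) t 0) * z) *
              besselPhi n t z) / 2) t := by
  have hder := (hasDerivAt_besselKappa (n + 1) t).ofReal_comp.mul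
    ((hasCoeffDerivAt_monicOPUC n t).eval (fun s => natDegree_monicOPUC_le (n + 1) s) z)
  rw [funext fun s => besselPhi_eq (n + 1) s z]
  refine hder.congr_deriv ?_
  have hI : (besselI 0 t : ℂ) ≠ 0 := by exact_mod_cast (besselI_zero_pos t).ne'
  have hk : ∀ m, (besselKappa m t : ℂ) ≠ 0 := fun m => by
    exact_mod_cast (besselKappa_pos m t).ne'
  have hr : (reflectionCoeff (n + 1) t : ℂ) ≠ 0 := by
    exact_mod_cast reflectionCoeff_ne_zero (n + 1) ht
  have hsq : (besselKappa (n + 1) t : ℂ) ^ 2 * (1 - (reflectionCoeff (n + 1) t : ℂ) ^ 2) =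
      (besselKappa n t : ℂ) ^ 2 := by exact_mod_cast besselKappa_sq_succ n t
  have hrec := congrArg (fun p => (p.map Complex.ofRealHom).eval z) (monicOPUC_succ n t)
  have hk1 := hk (n + 1)
  have hk2 := hk (n + 2)
  rw [besselPhi_zero_right, besselPhi_zero_right, besselPhi_eq, besselPhi_eq]
  simp only [Polynomial.map_mul, Polynomial.map_sub, Polynomial.map_add, map_X, map_C, eval_mul,
    eval_sub, eval_add, eval_X, eval_C, Complex.ofRealHom_eq_coe] at hrec ⊢
  generalize ((monicOPUC (n + 1) t).map Complex.ofRealHom).eval z = P' at hrec ⊢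
  generalize ((monicOPUC n t).map Complex.ofRealHom).eval z = P at hrec ⊢
  generalize ((reversedOPUC n t).map Complex.ofRealHom).eval z = Q at hrec ⊢
  push_cast
  generalize (reflectionCoeff (n + 1) t : ℂ) = r at *
  generalize (reflectionCoeff (n + 2) t : ℂ) = r' at *
  generalize (besselKappa (n + 1) t : ℂ) = k at *
  generalize (besselKappa n t : ℂ) = k0 at *
  generalize (besselKappa (n + 2) t : ℂ) = k2 at *
  have h1 : k2 * r' / k2 * (k / (k * r)) = r' / r := by field_simp
  have h2 : k0 / k * (1 + r' / r * z) * (k0 * P) = k * (1 - r ^ 2) * (1 + r' / r * z) * P := by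
    field_simp
    linear_combination -(r + r' * z) * P * hsq
  rw [h1, h2, hrec]
  field_simp
  ring

end

theorem lemma2p3 :
    -- `dφ_0/dt = 0`
    (∀ (t : ℝ) (z : ℂ), HasDerivAt (fun s : ℝ => besselPhi 0 s z) 0 t) ∧
    -- the denominators `φ_n(0)` do not vanish
    (∀ (n : ℕ) (t : ℝ), 1 ≤ n → t ≠ 0 → besselPhi n t 0 ≠ 0) ∧
    -- the differential relation for `φ_n(z)`
    (∀ (n : ℕ) (t : ℝ) (z : ℂ), 1 ≤ n → t ≠ 0 →
      DifferentiableAt ℝ (fun s : ℝ => besselPhi n s z) t ∧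
      2 * deriv (fun s : ℝ => besselPhi n s z) t =
        ((besselI 1 t : ℂ) / (besselI 0 t : ℂ) +
            besselPhi (n + 1) t 0 / (besselKappa (n + 1) t : ℂ) *
              ((besselKappa n t : ℂ) / besselPhi n t 0)) * besselPhi n t z -
          (besselKappa (n - 1) t : ℂ) / (besselKappa n t : ℂ) *
            (1 + besselPhi (n + 1) t 0 / (besselKappa (n + 1) t : ℂ) *
              ((besselKappa n t : ℂ) / besselPhi n t 0) * z) * besselPhi (n - 1) t z) ∧
    -- the differential equation for `κ_n`
    (∀ (n : ℕ) (t : ℝ), 1 ≤ n →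
      DifferentiableAt ℝ (fun s : ℝ => besselKappa n s) t ∧
      ((2 / besselKappa n t * deriv (fun s : ℝ => besselKappa n s) t : ℝ) : ℂ) =
        (besselI 1 t : ℂ) / (besselI 0 t : ℂ) +
          besselPhi (n + 1) t 0 / (besselKappa (n + 1) t : ℂ) *
            (besselPhi n t 0 / (besselKappa n t : ℂ))) ∧
    -- the differential equation for `φ_n(0)`
    (∀ (n : ℕ) (t : ℝ), 1 ≤ n → t ≠ 0 →
      DifferentiableAt ℝ (fun s : ℝ => besselPhi n s 0) t ∧
      2 / besselPhi n t 0 * deriv (fun s : ℝ => besselPhi n s 0) t =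
        (besselI 1 t : ℂ) / (besselI 0 t : ℂ) +
          besselPhi (n + 1) t 0 / (besselKappa (n + 1) t : ℂ) *
            ((besselKappa n t : ℂ) / besselPhi n t 0) -
          besselPhi (n - 1) t 0 / besselPhi n t 0 *
            ((besselKappa (n - 1) t : ℂ) / (besselKappa n t : ℂ))) := by
  refine ⟨fun t z => ?_, fun n t _ ht => ?_, fun n t z hn ht => ?_, fun n t _ => ?_,
    fun n t hn ht => ?_⟩
  · simpa only [besselPhi_zero_left] using hasDerivAt_const t (1 : ℂ)
  · rw [besselPhi_zero_right]
    exact_mod_cast mul_ne_zero (besselKappa_pos n t).ne' (reflectionCoeff_ne_zero n ht)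
  · obtain ⟨n, rfl⟩ : ∃ k, n = k + 1 := ⟨n - 1, by omega⟩
    have h := hasDerivAt_besselPhi n t ht z
    refine ⟨h.differentiableAt, ?_⟩
    rw [h.deriv, mul_div_cancel₀ _ two_ne_zero]
    rfl
  · have h := hasDerivAt_besselKappa n t
    refine ⟨h.differentiableAt, ?_⟩
    have hk : ∀ m, (besselKappa m t : ℂ) ≠ 0 := fun m => by
      exact_mod_cast (besselKappa_pos m t).ne'
    have hk1 := hk n
    have hk2 := hk (n + 1)
    have hI : (besselI 0 t : ℂ) ≠ 0 := by exact_mod_cast (besselI_zero_pos t).ne'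
    rw [h.deriv, besselPhi_zero_right, besselPhi_zero_right]
    push_cast
    field_simp
  · obtain ⟨n, rfl⟩ : ∃ k, n = k + 1 := ⟨n - 1, by omega⟩
    have h := hasDerivAt_besselPhi n t ht 0
    refine ⟨h.differentiableAt, ?_⟩
    have hp : besselPhi (n + 1) t 0 ≠ 0 := by
      rw [besselPhi_zero_right]
      exact_mod_cast mul_ne_zero (besselKappa_pos _ t).ne' (reflectionCoeff_ne_zero _ ht)
    rw [h.deriv, Nat.add_sub_cancel]
    field_simp
    ring
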